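/- Let $G$ be a (finite-dimensional, smooth, real) Lie group with identity element $e$, identity component $G_0$ and finitely many connected components, $n_G$ in number. Let $\xi_1,\dots,\xi_q$ generate $\mathrm{Lie}(G)\cong T_eG$ as a Lie algebra (via linear combinations and Lie brackets), and let $g_1,\dots,g_{n_G-1}\in G$ contain one element from each non-identity component of $G$. The exponential map is $\exp(\xi)=\gamma(1)$, where $\gamma:\mathbb R\to G$ is the integral curve with $\gamma(0)=e$ of the left-invariant vector field determined by $\xi$. **Sections of vector bundles.** Let $\pi:E\to\mathcal M$ be a smooth real vector bundle of finite rank over a smooth manifold, and let $\Theta:E\times G\to E$ be a smooth right action which descends under $\pi$ to a smooth right action $\theta:\mathcal M\times G\to\mathcal M$ and such that each $\Theta_g=\Theta(\cdot,g)$ is linear from $E_p$ to $E_{\theta(p,g)}$ for every $p$. On the vector space $\Sigma(E)$ of all (not necessarily continuous) sections of $E$, with the topology of pointwise convergence, define the linear operators $$\mathcal K_gF=\Theta_{g^{-1}}\circ F\circ\theta_g\quad(g\in G),\qquad \mathcal L_\xi F=\lim_{t\to0}\frac1t\big(\mathcal K_{\exp(t\xi)}F-F\big)\quad(\xi\in\mathrm{Lie}(G)),$$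 where the domain $D(\mathcal L_\xi)\subset\Sigma(E)$ consists of all $F$ for which the limit exists. For a subset $H\subset G$, the section $F$ is called $H$-equivariant if $\mathcal K_hF=F$ for all $h\in H$. Let $F$ be a continuous section of $E$. Then: 1. $F$ is $G_0$-equivariant if and only if $F\in D(\mathcal L_{\xi_i})$ and $\mathcal L_{\xi_i}F=0$ for $i=1,\dots,q$. 2. If, in addition to $F\in D(\mathcal L_{\xi_i})$ and $\mathcal L_{\xi_i}F=0$ for $i=1,\dots,q$, we have $\mathcal K_{g_j}F=F$ for $j=1,\dots,n_G-1$, then $F$ is $G$-equivariant. **Maps between vector spaces.** Let $\mathcal V,\mathcal W$ be finite-dimensional real vector spaces, let $\theta:\mathcal V\times G\to\mathcal V$ be a smooth (possibly nonlinear) right action and let $T:\mathcal V\times G\to GL(\mathcal W)$ be a smooth map with $T(x,gh)=T(\theta(x,g),h)\,T(x,g)$ and $T(x,e)=I$ for all $x\in\mathcal V$ and $g,h\in G$. For maps $f:\mathcal V\to\mathcal W$ define the linear operators $$(\mathcal K_gf)(x)=T(x,g)^{-1}f(\theta(x,g)),\qquad(\mathcal L_\xi f)(x)=\frac{d}{dt}\Big|_{t=0}(\mathcal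 K_{\exp(t\xi)}f)(x),$$ the domain of $\mathcal L_\xi$ being the set of all $f$ for which the derivative exists at every $x$. If $f$ is continuously differentiable, then: 3. $f$ is in the domain of $\mathcal L_\xi$ for every $\xi\in\mathrm{Lie}(G)$, and $f$ is $G$-equivariant (that is, $\mathcal K_gf=f$ for all $g\in G$) if and only if the finitely many linear constraints $\mathcal L_{\xi_i}f=0$ for $i=1,\dots,q$ and $\mathcal K_{g_j}f-f=0$ for $j=1,\dots,n_G-1$ hold. -/

import Mathlib

open Set Filter Topology Manifold Bundle
open scoped ContDiff

noncomputable section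

namespace SymLie

/-- A smooth real Lie group has the smoothness that Mathlib's Lie bracket on its tangent space at
the identity asks for. -/
instance instLieGroupMinSmoothness {EG HG : Type*} [NormedAddCommGroup EG] [NormedSpace ℝ EG]
    [TopologicalSpace HG] {IG : ModelWithCorners ℝ EG HG}
    {G : Type*} [TopologicalSpace G] [ChartedSpace HG G] [Group G] [LieGroup IG ∞ G] :
    LieGroup IG (minSmoothness ℝ 3) G :=
  LieGroup.of_le (n := ∞) (by
    rw [minSmoothness_of_isRCLikeNormedField]; exact ENat.LEInfty.out)

theorem mfderiv_mul_left_invariant {EG HG : Type*} [NormedAddCommGroup EG] [NormedSpace ℝ EG]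
    [TopologicalSpace HG] (IG : ModelWithCorners ℝ EG HG)
    {G : Type*} [TopologicalSpace G] [ChartedSpace HG G] [Group G] [LieGroup IG ∞ G]
    (ξ : GroupLieAlgebra IG G) (g h : G) :
    mfderiv IG IG (fun x : G => g * x) h (mulInvariantVectorField ξ h) =
      mulInvariantVectorField ξ (g * h) := by
  have hd : ∀ a : G, MDifferentiable IG IG (fun x : G => a * x) := fun a =>
    (contMDiff_mul_left (I := IG) (n := ∞) (a := a)).mdifferentiable (by simp)
  have hc : (fun x : G => g * h * x) = (fun x : G => g * x) ∘ (fun x : G => h * x) := by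
    funext x; simp [mul_assoc]
  have hm := mfderiv_comp_of_eq (I := IG) (I' := IG) (I'' := IG) (x := (1 : G)) (y := h)
    (hd g h) (hd h 1) (mul_one h)
  unfold mulInvariantVectorField
  rw [hc, hm]
  have key : ∀ k : G, k = h → ∀ v : EG,
      (show EG from mfderiv IG IG (fun x : G => g * x) h v) =
        (show EG from mfderiv IG IG (fun x : G => g * x) k v) := by
    rintro _ rfl v
    rfl
  exact key (h * 1) (mul_one h) _

/-- Left translates of integral curves of a left-invariant vector field are integral curves. -/
theorem isMIntegralCurveOn_mul_left {EG HG : Type*} [NormedAddCommGroup EG]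
    [NormedSpace ℝ EG] [TopologicalSpace HG] (IG : ModelWithCorners ℝ EG HG)
    {G : Type*} [TopologicalSpace G] [ChartedSpace HG G] [Group G] [LieGroup IG ∞ G]
    (ξ : GroupLieAlgebra IG G) {γ : ℝ → G} {s : Set ℝ}
    (h : IsMIntegralCurveOn γ (mulInvariantVectorField ξ) s) (g : G) :
    IsMIntegralCurveOn (fun t => g * γ t) (mulInvariantVectorField ξ) s := by
  intro t ht
  have h1 := h t ht
  have h2 : HasMFDerivAt IG IG (fun x : G => g * x) (γ t) _ :=
    ((contMDiff_mul_left (I := IG) (n := ∞) (a := g)).mdifferentiable (by simp) (γ t)).hasMFDerivAt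
  have h3 := h2.comp_hasMFDerivWithinAt t h1
  refine h3.congr_mfderiv ?_
  have h4 := mfderiv_mul_left_invariant IG ξ g (γ t)
  refine ContinuousLinearMap.ext_ring ?_
  change mfderiv IG IG (fun x : G => g * x) (γ t) ((1 : ℝ) • mulInvariantVectorField ξ (γ t)) =
    (1 : ℝ) • mulInvariantVectorField ξ (g * γ t)
  rw [one_smul, one_smul]
  exact h4

section ExponentialMap

variable {EG HG : Type*} [NormedAddCommGroup EG] [NormedSpace ℝ EG] [FiniteDimensional ℝ EG]
  [TopologicalSpace HG] (IG : ModelWithCorners ℝ EG HG) [IG.Boundaryless]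
  {G : Type*} [TopologicalSpace G] [ChartedSpace HG G] [Group G] [LieGroup IG ∞ G]

/-- A left-invariant vector field on a Lie group has a complete integral curve through `1`. -/
theorem exists_integralCurve [T2Space G] (ξ : GroupLieAlgebra IG G) :
    ∃ γ : ℝ → G, γ 0 = 1 ∧ IsMIntegralCurve γ (mulInvariantVectorField ξ) := by
  have : CompleteSpace EG := FiniteDimensional.complete ℝ EG
  have hv : ContMDiff IG IG.tangent 1
      (fun g : G => (mulInvariantVectorField ξ g : TangentBundle IG G)) :=
    (contMDiff_mulInvariantVectorField ξ).of_le (by simp)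
  obtain ⟨γ, hγ0, hγ⟩ := exists_isMIntegralCurveAt_of_contMDiffAt_boundaryless 0 (hv 1)
  rw [isMIntegralCurveAt_iff'] at hγ
  obtain ⟨ε, hε, hγ⟩ := hγ
  refine exists_isMIntegralCurve_of_isMIntegralCurveOn hv hε (fun g => ?_) 1
  refine ⟨fun t => g * γ t, by simp [hγ0], ?_⟩
  rw [Real.ball_eq_Ioo, zero_sub, zero_add] at hγ
  exact isMIntegralCurveOn_mul_left IG ξ hγ g

/-- The exponential map: `exp ξ = γ 1`, where `γ : ℝ → G` is the integral curve with `γ 0 = 1` of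
the left-invariant vector field defined by `ξ`. -/
def lieExp [T2Space G] (ξ : GroupLieAlgebra IG G) : G :=
  (exists_integralCurve IG ξ).choose 1

end ExponentialMap

/-- A smooth right action of `G` on the manifold `X`. -/
structure SmoothRightAction {EG HG : Type*} [NormedAddCommGroup EG] [NormedSpace ℝ EG]
    [TopologicalSpace HG] (IG : ModelWithCorners ℝ EG HG)
    {EX HX : Type*} [NormedAddCommGroup EX] [NormedSpace ℝ EX]
    [TopologicalSpace HX] (IX : ModelWithCorners ℝ EX HX)
    (G : Type*) [TopologicalSpace G] [ChartedSpace HG G] [Group G]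
    (X : Type*) [TopologicalSpace X] [ChartedSpace HX X] where
  act : X → G → X
  contMDiff_act : ContMDiff (IX.prod IG) IX ∞ (fun q : X × G => act q.1 q.2)
  act_act : ∀ (x : X) (g h : G), act (act x g) h = act x (g * h)
  act_one : ∀ x : X, act x 1 = x

section OperatorDerivative

variable {S : Type*} [AddCommGroup S] [Module ℝ S] [TopologicalSpace S] [T2Space S]
  [IsTopologicalAddGroup S] [ContinuousConstSMul ℝ S]

/-- For a family `A t` of linear operators on a topological vector space `S`, the (in general only
partially defined) linear operator `F ↦ lim_{t → 0} t⁻¹ (A t F - F)`, whose domain consists of all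
`F` for which the limit exists in `S`. -/
def generatorAtZero (A : ℝ → S →ₗ[ℝ] S) : S →ₗ.[ℝ] S where
  domain :=
    { carrier := {F | ∃ F' : S, Tendsto (fun t : ℝ => t⁻¹ • (A t F - F)) (𝓝[≠] 0) (𝓝 F')}
      add_mem' := by
        rintro F₁ F₂ ⟨F₁', h₁⟩ ⟨F₂', h₂⟩
        refine ⟨F₁' + F₂', (h₁.add h₂).congr fun t => ?_⟩
        rw [map_add, ← smul_add]
        congr 1
        abel
      zero_mem' := ⟨0, by simp⟩
      smul_mem' := by
        rintro c F ⟨F', h⟩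
        refine ⟨c • F', (h.const_smul c).congr fun t => ?_⟩
        rw [map_smul, smul_comm, smul_sub] }
  toFun :=
    { toFun := fun F => F.2.choose
      map_add' := fun F₁ F₂ => by
        refine tendsto_nhds_unique (F₁ + F₂).2.choose_spec
          ((F₁.2.choose_spec.add F₂.2.choose_spec).congr fun t => ?_)
        rw [← smul_add, Submodule.coe_add, map_add]
        congr 1
        abel
      map_smul' := fun c F => by
        refine tendsto_nhds_unique (c • F).2.choose_spec
          ((F.2.choose_spec.const_smul c).congr fun t => ?_)
        rw [Submodule.coe_smul, map_smul, smul_comm, smul_sub] }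

end OperatorDerivative

/-- The element of the vector space `E p` given by a point of the total space lying over `p`. -/
def fiberElt {M R : Type*} {E : M → Type*} (p : M) (v : TotalSpace R E) (h : v.proj = p) : E p :=
  h ▸ v.2

theorem fiberElt_eq {M R : Type*} {E : M → Type*} {p : M} {v : TotalSpace R E} (h : v.proj = p)
    {w : E p} (hw : v = ⟨p, w⟩) : fiberElt p v h = w := by
  subst hw
  rfl

/-- The fibres of a topological vector bundle are Hausdorff topological vector spaces. -/
theorem fiber_topology {M R : Type*} [TopologicalSpace M] [NormedAddCommGroup R] [NormedSpace ℝ R]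
    (E : M → Type*) [∀ p, AddCommGroup (E p)] [∀ p, Module ℝ (E p)]
    [TopologicalSpace (TotalSpace R E)] [∀ p, TopologicalSpace (E p)] [FiberBundle R E]
    [VectorBundle ℝ R E] (p : M) :
    T2Space (E p) ∧ IsTopologicalAddGroup (E p) ∧ ContinuousConstSMul ℝ (E p) := by
  let φ : E p ≃L[ℝ] R := (trivializationAt R E p).continuousLinearEquivAt ℝ p
    (mem_baseSet_trivializationAt R E p)
  have hφ : IsInducing φ := φ.toHomeomorph.isInducing
  refine ⟨φ.toHomeomorph.symm.t2Space, ?_, ?_⟩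
  · exact hφ.topologicalAddGroup φ
  · refine ⟨fun c => hφ.continuous_iff.2 ?_⟩
    have : (φ ∘ fun v => c • v) = fun v => c • φ v := by
      funext v
      simp
    rw [this]
    exact φ.continuous.const_smul c

section VectorBundle

variable {EG HG : Type*} [NormedAddCommGroup EG] [NormedSpace ℝ EG]
  [TopologicalSpace HG] (IG : ModelWithCorners ℝ EG HG)
  (G : Type*) [TopologicalSpace G] [ChartedSpace HG G] [Group G]
  {EM HM : Type*} [NormedAddCommGroup EM] [NormedSpace ℝ EM]
  [TopologicalSpace HM] (IM : ModelWithCorners ℝ EM HM)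
  {M : Type*} [TopologicalSpace M] [ChartedSpace HM M]
  (R : Type*) [NormedAddCommGroup R] [NormedSpace ℝ R]
  (E : M → Type*) [∀ p, AddCommGroup (E p)] [∀ p, Module ℝ (E p)]
  [TopologicalSpace (TotalSpace R E)] [∀ p, TopologicalSpace (E p)] [FiberBundle R E]

/-- A smooth fibre-linear right action `Θ` of `G` on a vector bundle `E → M` with model fibre `R`:
a smooth right action `total` on the total space which descends to a smooth right action `base` on
`M` and maps each fibre linearly to a fibre. -/
structure FiberLinearAction where
  total : SmoothRightAction IG (IM.prod 𝓘(ℝ, R)) G (TotalSpace R E)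
  base : SmoothRightAction IG IM G M
  proj_total : ∀ (v : TotalSpace R E) (g : G), (total.act v g).proj = base.act v.proj g
  linear_total : ∀ (p : M) (g : G), ∃ L : E p →ₗ[ℝ] E (base.act p g),
    ∀ v : E p, total.act ⟨p, v⟩ g = ⟨base.act p g, L v⟩

variable {IG G IM R E}

namespace FiberLinearAction

variable (Θ : FiberLinearAction IG G IM R E)

theorem proj_aux (F : ∀ p, E p) (g : G) (p : M) :
    (Θ.total.act ⟨Θ.base.act p g, F (Θ.base.act p g)⟩ g⁻¹).proj = p := by
  rw [Θ.proj_total, Θ.base.act_act, mul_inv_cancel, Θ.base.act_one]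

theorem exists_linear_fiberElt (p q : M) (g : G) (hq : Θ.base.act q g = p) :
    ∃ L : E q →ₗ[ℝ] E p, ∀ (v : E q) (h : (Θ.total.act ⟨q, v⟩ g).proj = p),
      fiberElt p (Θ.total.act ⟨q, v⟩ g) h = L v := by
  subst hq
  obtain ⟨L, hL⟩ := Θ.linear_total q g
  exact ⟨L, fun v h => fiberElt_eq h (hL v)⟩

/-- The transformation operator `K_g F = Θ_{g⁻¹} ∘ F ∘ θ_g`, a linear operator on the space of all
(possibly rough) sections of `E`. -/
def K (g : G) : (∀ p, E p) →ₗ[ℝ] (∀ p, E p) where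
  toFun F p := fiberElt p (Θ.total.act ⟨Θ.base.act p g, F (Θ.base.act p g)⟩ g⁻¹)
    (Θ.proj_aux F g p)
  map_add' F₁ F₂ := by
    funext p
    obtain ⟨L, hL⟩ := Θ.exists_linear_fiberElt p (Θ.base.act p g) g⁻¹
      (by rw [Θ.base.act_act, mul_inv_cancel, Θ.base.act_one])
    simp only [Pi.add_apply, hL, map_add]
  map_smul' c F := by
    funext p
    obtain ⟨L, hL⟩ := Θ.exists_linear_fiberElt p (Θ.base.act p g) g⁻¹
      (by rw [Θ.base.act_act, mul_inv_cancel, Θ.base.act_one])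
    simp only [Pi.smul_apply, hL, map_smul, RingHom.id_apply]

variable [FiniteDimensional ℝ EG] [IG.Boundaryless] [LieGroup IG ∞ G] [T2Space G]
  [VectorBundle ℝ R E]

/-- The Lie derivative `L_ξ F = lim_{t → 0} t⁻¹ (K_{exp (t ξ)} F - F)`, a linear operator whose
domain consists of the sections for which the limit exists pointwise. -/
def lieDeriv (ξ : GroupLieAlgebra IG G) : (∀ p, E p) →ₗ.[ℝ] (∀ p, E p) :=
  have := fun p => (fiber_topology (R := R) E p).1
  have := fun p => (fiber_topology (R := R) E p).2.1
  have := fun p => (fiber_topology (R := R) E p).2.2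
  generatorAtZero fun t : ℝ => Θ.K (lieExp IG (t • ξ))

end FiberLinearAction

end VectorBundle

section VectorSpace

variable {EG HG : Type*} [NormedAddCommGroup EG] [NormedSpace ℝ EG]
  [TopologicalSpace HG] (IG : ModelWithCorners ℝ EG HG)
  (G : Type*) [TopologicalSpace G] [ChartedSpace HG G] [Group G]
  (V W : Type*) [NormedAddCommGroup V] [NormedSpace ℝ V] [NormedAddCommGroup W] [NormedSpace ℝ W]

/-- A right action `Θ(x, y, g) = (θ(x, g), T(x, g) y)` of `G` on `V × W`, where `base` is `θ`, a
smooth (possibly nonlinear) right action on `V`, and `T : V × G → GL(W)` is smooth. -/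
structure ProductAction where
  base : SmoothRightAction IG 𝓘(ℝ, V) G V
  T : V → G → (W ≃L[ℝ] W)
  contMDiff_T : ContMDiff (𝓘(ℝ, V).prod IG) 𝓘(ℝ, W →L[ℝ] W) ∞
    (fun q : V × G => (T q.1 q.2 : W →L[ℝ] W))
  T_mul : ∀ (x : V) (g h : G) (y : W), T x (g * h) y = T (base.act x g) h (T x g y)
  T_one : ∀ (x : V) (y : W), T x 1 y = y

namespace ProductAction

variable {IG G V W} (Θ : ProductAction IG G V W)

/-- The transformation operator `(K_g F)(x) = T(x, g)⁻¹ F(θ_g(x))`, a linear operator on maps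
`V → W`. -/
def K (g : G) : (V → W) →ₗ[ℝ] (V → W) where
  toFun F x := (Θ.T x g).symm (F (Θ.base.act x g))
  map_add' F₁ F₂ := by
    funext x
    simp
  map_smul' c F := by
    funext x
    simp

variable [FiniteDimensional ℝ EG] [IG.Boundaryless] [LieGroup IG ∞ G] [T2Space G]

/-- The Lie derivative `(L_ξ F)(x) = d/dt|_{t = 0} (K_{exp (t ξ)} F)(x)`, a linear operator on maps
`V → W` whose domain consists of the maps for which the derivative exists at every `x`. -/
def lieDeriv (ξ : GroupLieAlgebra IG G) : (V → W) →ₗ.[ℝ] (V → W) :=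
  generatorAtZero fun t : ℝ => Θ.K (lieExp IG (t • ξ))

end ProductAction

end VectorSpace

end SymLie

end

/-! The operators `K g` form a representation, so the elements fixing a section form a subgroup `H`.
If the Lie derivative along `ξ i` vanishes, then `t ↦ K (exp (t ξ i)) F p` is a curve in one
finite-dimensional fibre; by the group law its derivative at `t` is a linear image of the derivative
at `0`, hence zero. So `H` contains the one-parameter subgroups of the generators
(`eq_self_of_tendsto_generator_zero`).

The rest is about an abstract subgroup `H`, not assumed closed (`subgroup_mem_nhds_one_of_lieSpan`).
Let `S` be the set of velocities of one-parameter subgroups inside `H`. Conjugation by `H` preserves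
`S`, so `Ad` of `H` preserves `span S`; differentiating `Ad (exp (t v)) w ∈ span S` at `t = 0` gives
`⁅v, w⁆ ∈ span S` for `v ∈ S`. Thus `span S` is a Lie subalgebra containing the generators, hence
everything. For a basis taken from `S`, the product of the exponentials has invertible derivative at
`0`, so `H` is a neighbourhood of `1`. Then `H` is open and closed and contains the identity
component; one representative per further component gives all of `G`.

Maps between vector spaces are the case of constant fibres, where it remains to check that a
continuously differentiable `f` lies in the domain. -/

namespace SymLie

/-! ### The Lie bracket as the derivative of conjugation, in coordinates. -/

section Calculus

variable {E : Type*} [NormedAddCommGroup E] [NormedSpace ℝ E]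

/-- Let `μ` be a product near `(a, a)` with neutral element `a`, and let `V_u` be the left-invariant
vector field with value `u` at `a`. If a closed subspace `K` contains the vectors obtained from `w`
by conjugation with the points of a curve of velocity `v`, then it contains `[V_v, V_w]`. -/
theorem lieBracket_mem_of_conj_mem [CompleteSpace E] {μ : E × E → E} {a v w : E}
    (hμ : ContDiffAt ℝ 2 μ (a, a))
    (hl : ∀ u, fderiv ℝ μ (a, a) (u, 0) = u) (hr : ∀ u, fderiv ℝ μ (a, a) (0, u) = u)
    {K : Submodule ℝ E} (hK : IsClosed (K : Set E)) {c g : ℝ → E} (hc0 : c 0 = a)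
    (hc : HasDerivAt c v 0) (hgK : ∀ t, g t ∈ K)
    (hg : ∀ᶠ t in 𝓝 0, fderiv ℝ μ (a, c t) (g t, 0) = fderiv ℝ μ (c t, a) (0, w)) :
    VectorField.lieBracket ℝ (fun x => fderiv ℝ μ (x, a) (0, v))
      (fun x => fderiv ℝ μ (x, a) (0, w)) a ∈ K := by
  have hD : HasFDerivAt (fderiv ℝ μ) (fderiv ℝ (fderiv ℝ μ) (a, a)) (a, a) :=
    ((hμ.fderiv_right (m := 1) (by norm_num)).differentiableAt (by simp)).hasFDerivAt
  have hsymm : IsSymmSndFDerivAt ℝ μ (a, a) := hμ.isSymmSndFDerivAt (by simp)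
  set D := fderiv ℝ (fderiv ℝ μ) (a, a) with hDdef
  have hV : ∀ u, HasFDerivAt (fun x => fderiv ℝ μ (x, a) (0, u))
      ((ContinuousLinearMap.apply ℝ E ((0, u) : E × E)) ∘L D ∘L ContinuousLinearMap.inl ℝ E E) a := by
    intro u
    have h1 : HasFDerivAt (fun x : E => (x, a)) (ContinuousLinearMap.inl ℝ E E) a :=
      hasFDerivAt_prodMk_left a a
    have h2 : HasFDerivAt (fun x : E => fderiv ℝ μ (x, a)) (D ∘L ContinuousLinearMap.inl ℝ E E) a :=
      HasFDerivAt.comp a hD h1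
    exact (ContinuousLinearMap.apply ℝ E ((0, u) : E × E)).hasFDerivAt.comp a h2
  -- Symmetry of the second derivative rewrites `D (w, 0) (0, v)` as `D (0, v) (w, 0)`, the
  -- derivative along `c` of right translation applied to `w`.
  have hbr : VectorField.lieBracket ℝ (fun x => fderiv ℝ μ (x, a) (0, v))
      (fun x => fderiv ℝ μ (x, a) (0, w)) a = D (v, 0) (0, w) - D (0, v) (w, 0) := by
    rw [VectorField.lieBracket_eq]
    simp only [(hV v).fderiv, (hV w).fderiv, hr]
    simp only [ContinuousLinearMap.comp_apply, ContinuousLinearMap.inl_apply,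
      ContinuousLinearMap.apply_apply]
    rw [hsymm (w, 0) (0, v)]
  have hA : HasDerivAt (fun t => fderiv ℝ μ (a, c t)) (D (0, v)) 0 := by
    have h1 : HasDerivAt (fun t => (a, c t)) ((0 : E), v) 0 := (hasDerivAt_const 0 a).prodMk hc
    exact HasFDerivAt.comp_hasDerivAt_of_eq (0 : ℝ) hD h1 (by rw [hc0])
  have hB : HasDerivAt (fun t => fderiv ℝ μ (c t, a)) (D (v, 0)) 0 := by
    have h1 : HasDerivAt (fun t => (c t, a)) (v, (0 : E)) 0 := hc.prodMk (hasDerivAt_const 0 a)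
    exact HasFDerivAt.comp_hasDerivAt_of_eq (0 : ℝ) hD h1 (by rw [hc0])
  -- By `hg`, `A t (g t)` is the left translate of `w`, so `g t - w` is `(A t)⁻¹` applied to the
  -- difference of the left and right translates of `w`. As `A t → 1`, the quotient `t⁻¹ • (g t -
  -- w)` tends to the bracket, with no regularity of `g` assumed.
  let A : ℝ → E →L[ℝ] E := fun t => fderiv ℝ μ (a, c t) ∘L ContinuousLinearMap.inl ℝ E E
  have hA0 : A 0 = 1 := by
    ext u
    simp [A, hc0, hl]
  have hAc : Tendsto A (𝓝 0) (𝓝 1) := by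
    rw [← hA0]
    exact (hA.continuousAt.clm_comp continuousAt_const)
  have hg0 : g 0 = w := by
    have := hg.self_of_nhds
    rwa [hc0, hl, hr] at this
  have hinv : Tendsto (fun t => Ring.inverse (A t)) (𝓝 0) (𝓝 1) := by
    have h1 : ContinuousAt Ring.inverse ((1 : (E →L[ℝ] E)ˣ) : E →L[ℝ] E) :=
      NormedRing.inverse_continuousAt 1
    simpa [Function.comp_def] using h1.tendsto.comp (by simpa using hAc)
  have hdiff : Tendsto (fun t : ℝ => t⁻¹ • (fderiv ℝ μ (c t, a) (0, w) - fderiv ℝ μ (a, c t) (w, 0)))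
      (𝓝[≠] 0) (𝓝 (D (v, 0) (0, w) - D (0, v) (w, 0))) := by
    have h1 := (hB.clm_apply (hasDerivAt_const 0 ((0 : E), w))).sub
      (hA.clm_apply (hasDerivAt_const 0 (w, (0 : E))))
    rw [hasDerivAt_iff_tendsto_slope_zero] at h1
    simpa [hc0, hl, hr] using h1
  have hunit : ∀ᶠ t in 𝓝 0, IsUnit (A t) :=
    hAc.eventually (Units.isOpen.mem_nhds (x := (1 : E →L[ℝ] E)) isUnit_one)
  have hlim := (isBoundedBilinearMap_apply (𝕜 := ℝ) (E := E) (F := E)).continuous.tendsto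
    (1, D (v, 0) (0, w) - D (0, v) (w, 0)) |>.comp
      ((hinv.mono_left nhdsWithin_le_nhds).prodMk_nhds hdiff)
  rw [hbr]
  refine hK.mem_of_tendsto (b := 𝓝[≠] (0 : ℝ)) (f := fun t : ℝ => t⁻¹ • (g t - w)) ?_
    (Eventually.of_forall fun t => K.smul_mem _ (K.sub_mem (hgK t) (hg0 ▸ hgK 0)))
  refine Tendsto.congr' ?_ hlim
  filter_upwards [nhdsWithin_le_nhds hg, nhdsWithin_le_nhds hunit] with t h1 h2
  simp only [Function.comp_apply]
  rw [← h1, map_smul, ← map_sub]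
  congr 1
  have h3 : ((g t, 0) - (w, 0) : E × E) = ContinuousLinearMap.inl ℝ E E (g t - w) := by simp
  rw [h3]
  change (Ring.inverse (A t) * A t) (g t - w) = g t - w
  rw [Ring.inverse_mul_cancel _ h2]
  rfl

end Calculus

/-! ### Vectors fixed by one-parameter groups, and generators. -/

section OneParameterGroup

variable {P : Type*} {E : P → Type*} [∀ p, AddCommGroup (E p)] [∀ p, Module ℝ (E p)]
  [∀ p, TopologicalSpace (E p)] {R : Type*} [NormedAddCommGroup R] [NormedSpace ℝ R]
  [FiniteDimensional ℝ R]

/-- A section annihilated by the generator of a one-parameter group of operators acting fibrewise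
is fixed by the group. -/
theorem eq_self_of_tendsto_generator_zero (e : ∀ p, E p ≃L[ℝ] R)
    (A : ℝ → (∀ p, E p) →ₗ[ℝ] (∀ p, E p)) (F : ∀ p, E p) (hzero : A 0 F = F)
    (hadd : ∀ s t, A (s + t) F = A s (A t F))
    (hloc : ∀ t p, ∃ q, ∃ L : E q →ₗ[ℝ] E p, ∀ F, A t F p = L (F q))
    (h : Tendsto (fun t : ℝ => t⁻¹ • (A t F - F)) (𝓝[≠] 0) (𝓝 0)) (t : ℝ) : A t F = F := by
  funext p
  have hder : ∀ t, HasDerivAt (fun t => e p (A t F p)) 0 t := by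
    intro t
    rw [hasDerivAt_iff_tendsto_slope_zero]
    obtain ⟨q, L, hL⟩ := hloc t p
    let N : R →ₗ[ℝ] R := (e p).toLinearMap ∘ₗ L ∘ₗ (e q).symm.toLinearMap
    -- The difference quotient at `t` is `N` applied to the one at `0`, so continuity of `N` carries
    -- the limit `0` over.
    have hN : Continuous N := LinearMap.continuous_of_finiteDimensional N
    have h1 : Tendsto (fun s : ℝ => N (e q ((s⁻¹ • (A s F - F)) q))) (𝓝[≠] 0) (𝓝 0) := by
      have h2 := ((hN.comp (e q).continuous).tendsto _).comp ((tendsto_pi_nhds.1 h) q)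
      simpa [Function.comp_def] using h2
    refine h1.congr fun s => ?_
    simp only [hadd, hL]
    simp [N]
  have hconst := is_const_of_deriv_eq_zero (fun t => (hder t).differentiableAt)
    (fun t => (hder t).deriv) t 0
  simpa [hzero] using hconst

end OneParameterGroup

section Generator

variable {S : Type*} [AddCommGroup S] [Module ℝ S] [TopologicalSpace S] [T2Space S]
  [IsTopologicalAddGroup S] [ContinuousConstSMul ℝ S]

theorem tendsto_generatorAtZero (A : ℝ → S →ₗ[ℝ] S) (F : (generatorAtZero A).domain) :
    Tendsto (fun t : ℝ => t⁻¹ • (A t F - F)) (𝓝[≠] 0) (𝓝 (generatorAtZero A F)) :=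
  F.2.choose_spec

theorem exists_generatorAtZero_eq_zero_iff (A : ℝ → S →ₗ[ℝ] S) (F : S) :
    (∃ h : F ∈ (generatorAtZero A).domain, generatorAtZero A ⟨F, h⟩ = 0) ↔
      Tendsto (fun t : ℝ => t⁻¹ • (A t F - F)) (𝓝[≠] 0) (𝓝 0) := by
  constructor
  · rintro ⟨h, h0⟩
    exact h0 ▸ tendsto_generatorAtZero A ⟨F, h⟩
  · intro h
    refine ⟨⟨0, h⟩, ?_⟩
    exact tendsto_nhds_unique (tendsto_generatorAtZero A ⟨F, ⟨0, h⟩⟩) h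

end Generator

/-! ### Derivatives between model spaces. -/

section ModelDeriv

variable {E H E' H' E'' H'' : Type*}
  [NormedAddCommGroup E] [NormedSpace ℝ E] [TopologicalSpace H] (I : ModelWithCorners ℝ E H)
  [NormedAddCommGroup E'] [NormedSpace ℝ E'] [TopologicalSpace H'] (I' : ModelWithCorners ℝ E' H')
  [NormedAddCommGroup E''] [NormedSpace ℝ E''] [TopologicalSpace H'']
  (I'' : ModelWithCorners ℝ E'' H'')
  {X X' X'' : Type*} [TopologicalSpace X] [ChartedSpace H X] [TopologicalSpace X']
  [ChartedSpace H' X'] [TopologicalSpace X''] [ChartedSpace H'' X'']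

/-- The derivative of a map of manifolds as a map of the model vector spaces. -/
noncomputable def modelDeriv (f : X → X') (x : X) : E →L[ℝ] E' := mfderiv I I' f x

variable {I I' I''}

/-- With values in the model spaces, the chain rule needs no transport between tangent spaces at
points that are only provably equal, such as `h * 1` and `h`. -/
theorem modelDeriv_comp_apply {f : X → X'} {g : X' → X''} {x : X} {y : X'}
    (hg : MDifferentiableAt I' I'' g y) (hf : MDifferentiableAt I I' f x) (hy : f x = y) (v : E) :
    modelDeriv I I'' (g ∘ f) x v = modelDeriv I' I'' g y (modelDeriv I I' f x v) := by
  subst hy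
  unfold modelDeriv
  rw [mfderiv_comp x hg hf]
  rfl

end ModelDeriv

/-! ### Left-invariant fields and conjugation, globally and in the chart at the identity. -/

section LieGroup

variable {EG HG : Type*} [NormedAddCommGroup EG] [NormedSpace ℝ EG]
  [TopologicalSpace HG] (IG : ModelWithCorners ℝ EG HG)
  {G : Type*} [TopologicalSpace G] [ChartedSpace HG G] [Group G]

/-- The product of a Lie group in the preferred chart at the identity. -/
noncomputable def chartMul (G : Type*) [TopologicalSpace G] [ChartedSpace HG G] [Group G] (p : EG × EG) : EG :=
  extChartAt IG (1 : G) ((extChartAt IG (1 : G)).symm p.1 * (extChartAt IG (1 : G)).symm p.2)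

/-- The derivative at the identity of conjugation by `h`. -/
noncomputable def lieAd (h : G) : EG →L[ℝ] EG := modelDeriv IG IG (fun k : G => h * k * h⁻¹) 1

/-- The left-invariant vector field with value `v` at the identity. -/
noncomputable def leftField (v : EG) (h : G) : EG := modelDeriv IG IG (fun k : G => h * k) 1 v

variable [LieGroup IG ∞ G]

theorem mdifferentiable_conj (h : G) : MDifferentiable IG IG (fun k : G => h * k * h⁻¹) :=
  ((contMDiff_mul_right (I := IG) (n := ∞) (a := h⁻¹)).comp
    (contMDiff_mul_left (I := IG) (n := ∞) (a := h))).mdifferentiable (by simp)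

theorem mdifferentiable_mul_left (h : G) : MDifferentiable IG IG (fun k : G => h * k) :=
  (contMDiff_mul_left (I := IG) (n := ∞) (a := h)).mdifferentiable (by simp)

theorem mdifferentiable_mul_right (h : G) : MDifferentiable IG IG (fun k : G => k * h) :=
  (contMDiff_mul_right (I := IG) (n := ∞) (a := h)).mdifferentiable (by simp)

/-- Conjugation is a homomorphism, so it intertwines left translation by `k` with left translation
by `h * k * h⁻¹`; differentiate this at `1`. -/
theorem modelDeriv_conj_leftField (h k : G) (w : EG) :
    modelDeriv IG IG (fun k : G => h * k * h⁻¹) k (leftField IG w k) =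
      leftField IG (lieAd IG h w) (h * k * h⁻¹) := by
  have hc : (fun k : G => h * k * h⁻¹) ∘ (fun x : G => k * x) =
      (fun x : G => (h * k * h⁻¹) * x) ∘ (fun k : G => h * k * h⁻¹) := by
    funext x; simp [mul_assoc]
  rw [leftField, ← modelDeriv_comp_apply (mdifferentiable_conj IG h k)
    (mdifferentiable_mul_left IG k 1) (mul_one k) w, hc]
  exact modelDeriv_comp_apply (mdifferentiable_mul_left IG (h * k * h⁻¹) 1)
    (mdifferentiable_conj IG h 1) (by simp) w

section Chart

variable {IG}

theorem contMDiffAt_extChartAt_one {h : G} (hh : h ∈ (extChartAt IG (1 : G)).source) :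
    ContMDiffAt IG 𝓘(ℝ, EG) ∞ (extChartAt IG (1 : G)) h :=
  contMDiffAt_extChartAt' (by simpa using hh)

theorem mdifferentiableAt_extChartAt_one {h : G} (hh : h ∈ (extChartAt IG (1 : G)).source) :
    MDifferentiableAt IG 𝓘(ℝ, EG) (extChartAt IG (1 : G)) h :=
  (contMDiffAt_extChartAt_one hh).mdifferentiableAt (by simp)

theorem mdifferentiableAt_extChartAt_mul_left {h : G} (hh : h ∈ (extChartAt IG (1 : G)).source) :
    MDifferentiableAt IG 𝓘(ℝ, EG) (extChartAt IG (1 : G) ∘ fun k : G => h * k) 1 :=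
  MDifferentiableAt.comp (I' := IG) 1 (mdifferentiableAt_extChartAt_one (by simpa using hh))
      (mdifferentiable_mul_left IG h 1)

theorem mdifferentiableAt_extChartAt_mul_right {h : G} (hh : h ∈ (extChartAt IG (1 : G)).source) :
    MDifferentiableAt IG 𝓘(ℝ, EG) (extChartAt IG (1 : G) ∘ fun k : G => k * h) 1 :=
  MDifferentiableAt.comp (I' := IG) 1 (mdifferentiableAt_extChartAt_one (by simpa using hh))
      (mdifferentiable_mul_right IG h 1)

variable [IG.Boundaryless]

theorem modelDeriv_one_eq_fderiv {F : Type*} [NormedAddCommGroup F] [NormedSpace ℝ F] {f : G → F}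
    (hf : MDifferentiableAt IG 𝓘(ℝ, F) f 1) :
    modelDeriv IG 𝓘(ℝ, F) f 1 =
      fderiv ℝ (f ∘ (extChartAt IG (1 : G)).symm) (extChartAt IG (1 : G) 1) := by
  have h : modelDeriv IG 𝓘(ℝ, F) f 1 =
      fderivWithin ℝ (f ∘ (extChartAt IG (1 : G)).symm) (range IG) (extChartAt IG (1 : G) 1) :=
    if_pos hf
  rw [h, IG.range_eq_univ, fderivWithin_univ]

/-- The tangent space at `1` is identified with `EG` by this very chart. -/
theorem modelDeriv_extChartAt_one :
    modelDeriv IG 𝓘(ℝ, EG) (extChartAt IG (1 : G)) 1 = ContinuousLinearMap.id ℝ EG := by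
  rw [modelDeriv_one_eq_fderiv (mdifferentiableAt_extChartAt_one (mem_extChartAt_source 1))]
  have h : (extChartAt IG (1 : G)) ∘ (extChartAt IG (1 : G)).symm
      =ᶠ[𝓝 (extChartAt IG (1 : G) 1)] id := by
    filter_upwards [extChartAt_target_mem_nhds (I := IG) (1 : G)] with x hx
    exact (extChartAt IG (1 : G)).right_inv hx
  rw [h.fderiv_eq, fderiv_id]

theorem contMDiffAt_extChartAt_one_symm {x : EG} (hx : x ∈ (extChartAt IG (1 : G)).target) :
    ContMDiffAt 𝓘(ℝ, EG) IG ∞ (extChartAt IG (1 : G)).symm x :=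
  (contMDiffOn_extChartAt_symm (I := IG) (n := ∞) (1 : G)).contMDiffAt
    ((isOpen_extChartAt_target (1 : G)).mem_nhds hx)

theorem contDiffAt_chartMul {h k : G} (hh : h ∈ (extChartAt IG (1 : G)).source)
    (hk : k ∈ (extChartAt IG (1 : G)).source) (hhk : h * k ∈ (extChartAt IG (1 : G)).source) :
    ContDiffAt ℝ ∞ (chartMul IG G) (extChartAt IG (1 : G) h, extChartAt IG (1 : G) k) := by
  rw [← contMDiffAt_iff_contDiffAt]
  set φ := extChartAt IG (1 : G) with hφ
  have h1 : ContMDiffAt 𝓘(ℝ, EG × EG) IG ∞ (fun p : EG × EG => φ.symm p.1) (φ h, φ k) :=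
    ContMDiffAt.comp (I' := 𝓘(ℝ, EG)) (φ h, φ k)
      (contMDiffAt_extChartAt_one_symm (φ.map_source hh)) contDiff_fst.contMDiff.contMDiffAt
  have h2 : ContMDiffAt 𝓘(ℝ, EG × EG) IG ∞ (fun p : EG × EG => φ.symm p.2) (φ h, φ k) :=
    ContMDiffAt.comp (I' := 𝓘(ℝ, EG)) (φ h, φ k)
      (contMDiffAt_extChartAt_one_symm (φ.map_source hk)) contDiff_snd.contMDiff.contMDiffAt
  refine ContMDiffAt.comp_of_eq (I' := IG) (y := h * k) (contMDiffAt_extChartAt_one hhk)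
    (h1.mul h2) ?_
  change φ.symm (φ h) * φ.symm (φ k) = h * k
  rw [φ.left_inv hh, φ.left_inv hk]

theorem modelDeriv_extChartAt_mul_left {h : G} (hh : h ∈ (extChartAt IG (1 : G)).source) (u : EG) :
    modelDeriv IG 𝓘(ℝ, EG) (extChartAt IG (1 : G) ∘ fun k : G => h * k) 1 u =
    fderiv ℝ (chartMul IG G) (extChartAt IG (1 : G) h, extChartAt IG (1 : G) 1) (0, u) := by
  rw [modelDeriv_one_eq_fderiv (mdifferentiableAt_extChartAt_mul_left hh)]
  have hm := (contDiffAt_chartMul hh (mem_extChartAt_source 1)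
    (by simpa using hh)).differentiableAt (by simp)
  set φ := extChartAt IG (1 : G) with hφ
  have hc : (φ ∘ fun k : G => h * k) ∘ φ.symm = chartMul IG G ∘ (fun y => (φ h, y)) := by
    funext y
    change _ = φ (φ.symm (φ h) * φ.symm y)
    rw [φ.left_inv hh]
    rfl
  rw [hc, (hm.hasFDerivAt.comp (φ 1) (hasFDerivAt_prodMk_right (φ h) (φ 1))).fderiv]
  rfl

theorem modelDeriv_extChartAt_mul_right {h : G} (hh : h ∈ (extChartAt IG (1 : G)).source) (u : EG) :
    modelDeriv IG 𝓘(ℝ, EG) (extChartAt IG (1 : G) ∘ fun k : G => k * h) 1 u =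
    fderiv ℝ (chartMul IG G) (extChartAt IG (1 : G) 1, extChartAt IG (1 : G) h) (u, 0) := by
  rw [modelDeriv_one_eq_fderiv (mdifferentiableAt_extChartAt_mul_right hh)]
  have hm := (contDiffAt_chartMul (mem_extChartAt_source 1) hh
    (by simpa using hh)).differentiableAt (by simp)
  set φ := extChartAt IG (1 : G) with hφ
  have hc : (φ ∘ fun k : G => k * h) ∘ φ.symm = chartMul IG G ∘ (fun y => (y, φ h)) := by
    funext y
    change _ = φ (φ.symm y * φ.symm (φ h))
    rw [φ.left_inv hh]
    rfl
  rw [hc, (hm.hasFDerivAt.comp (φ 1) (hasFDerivAt_prodMk_left (φ 1) (φ h))).fderiv]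
  rfl

/-- Left translation by `h` is conjugation by `h` followed by right translation by `h`. This
supplies the hypothesis `hg` of `lieBracket_mem_of_conj_mem`. -/
theorem fderiv_chartMul_lieAd {h : G} (hh : h ∈ (extChartAt IG (1 : G)).source) (w : EG) :
    fderiv ℝ (chartMul IG G) (extChartAt IG (1 : G) 1, extChartAt IG (1 : G) h)
        (lieAd IG h w, 0) =
      fderiv ℝ (chartMul IG G) (extChartAt IG (1 : G) h, extChartAt IG (1 : G) 1) (0, w) := by
  have hc : (extChartAt IG (1 : G) ∘ fun k : G => h * k) =
      (extChartAt IG (1 : G) ∘ fun k : G => k * h) ∘ (fun k : G => h * k * h⁻¹) := by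
    funext x; simp
  rw [← modelDeriv_extChartAt_mul_left hh, ← modelDeriv_extChartAt_mul_right hh, hc]
  exact (modelDeriv_comp_apply (mdifferentiableAt_extChartAt_mul_right hh)
    (mdifferentiable_conj IG h 1) (by simp) w).symm

theorem modelDeriv_extChartAt_leftField {h : G} (hh : h ∈ (extChartAt IG (1 : G)).source)
    (v : EG) :
    modelDeriv IG 𝓘(ℝ, EG) (extChartAt IG (1 : G)) h (leftField IG v h) =
      fderiv ℝ (chartMul IG G) (extChartAt IG (1 : G) h, extChartAt IG (1 : G) 1) (0, v) := by
  rw [← modelDeriv_extChartAt_mul_left hh]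
  exact (modelDeriv_comp_apply (mdifferentiableAt_extChartAt_one hh)
    (mdifferentiable_mul_left IG h 1) (mul_one h) v).symm

theorem fderiv_chartMul_one_right (u : EG) :
    fderiv ℝ (chartMul IG G) (extChartAt IG (1 : G) 1, extChartAt IG (1 : G) 1) (0, u) = u := by
  have : (extChartAt IG (1 : G) ∘ fun k : G => 1 * k) = extChartAt IG (1 : G) := by
    funext; simp
  rw [← modelDeriv_extChartAt_mul_left (mem_extChartAt_source 1), this, modelDeriv_extChartAt_one]
  rfl

theorem fderiv_chartMul_one_left (u : EG) :
    fderiv ℝ (chartMul IG G) (extChartAt IG (1 : G) 1, extChartAt IG (1 : G) 1) (u, 0) = u := by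
  have : (extChartAt IG (1 : G) ∘ fun k : G => k * 1) = extChartAt IG (1 : G) := by
    funext; simp
  rw [← modelDeriv_extChartAt_mul_right (mem_extChartAt_source 1), this, modelDeriv_extChartAt_one]
  rfl

/-- The bracket of the Lie algebra of a Lie group is the bracket of the left-invariant vector fields
in the preferred chart at the identity. -/
theorem bracket_eq_lieBracket_chartMul (v w : GroupLieAlgebra IG G) :
    ⁅v, w⁆ = VectorField.lieBracket ℝ
      (fun x => fderiv ℝ (chartMul IG G) (x, extChartAt IG (1 : G) 1) ((0 : EG), (v : EG)))
      (fun x => fderiv ℝ (chartMul IG G) (x, extChartAt IG (1 : G) 1) ((0 : EG), (w : EG)))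
      (extChartAt IG (1 : G) 1) := by
  have hM : IsManifold IG 1 G := IsManifold.of_le (n := ∞) (by simp)
  let P : EG → EG → EG := fun u => VectorField.mpullbackWithin 𝓘(ℝ, EG) IG
    (extChartAt IG (1 : G)).symm (leftField IG u) (range IG)
  have hP : ∀ u, P u =ᶠ[𝓝 (extChartAt IG (1 : G) 1)]
      (fun x => fderiv ℝ (chartMul IG G) (x, extChartAt IG (1 : G) 1) (0, u)) := by
    intro u
    filter_upwards [extChartAt_target_mem_nhds (I := IG) (1 : G)] with x hx
    have h1 := modelDeriv_extChartAt_leftField ((extChartAt IG (1 : G)).map_target hx) u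
    rw [(extChartAt IG (1 : G)).right_inv hx] at h1
    rw [← h1]
    exact DFunLike.congr_fun
      (ContinuousLinearMap.inverse_eq (mfderivWithin_extChartAt_symm_comp_mfderiv_extChartAt hx)
        (mfderiv_extChartAt_comp_mfderivWithin_extChartAt_symm hx))
      (leftField IG u ((extChartAt IG (1 : G)).symm x))
  have huniv : (extChartAt IG (1 : G)).symm ⁻¹' univ ∩ range IG = univ := by
    rw [preimage_univ, univ_inter, IG.range_eq_univ]
  -- The left-hand side is the definition of the manifold bracket, unfolded and written over `EG`:
  -- bracket the fields in the chart, then pull back to the group.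
  have key : ∀ a b : EG, (modelDeriv IG 𝓘(ℝ, EG) (extChartAt IG (1 : G)) 1).inverse
      (VectorField.lieBracketWithin ℝ (P a) (P b)
        ((extChartAt IG (1 : G)).symm ⁻¹' univ ∩ range IG) (extChartAt IG (1 : G) 1)) =
      VectorField.lieBracket ℝ
        (fun x => fderiv ℝ (chartMul IG G) (x, extChartAt IG (1 : G) 1) (0, a))
        (fun x => fderiv ℝ (chartMul IG G) (x, extChartAt IG (1 : G) 1) (0, b))
        (extChartAt IG (1 : G) 1) := by
    intro a b
    rw [huniv, VectorField.lieBracketWithin_univ, (hP a).lieBracket_vectorField_eq (hP b),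
      modelDeriv_extChartAt_one, ContinuousLinearMap.inverse_id]
    rfl
  exact key v w

end Chart

end LieGroup

/-! ### One-parameter subgroups. -/

section ExponentialCurve

variable {EG HG : Type*} [NormedAddCommGroup EG] [NormedSpace ℝ EG] [FiniteDimensional ℝ EG]
  [TopologicalSpace HG] {IG : ModelWithCorners ℝ EG HG} [IG.Boundaryless]
  {G : Type*} [TopologicalSpace G] [ChartedSpace HG G] [Group G] [LieGroup IG ∞ G] [T2Space G]

theorem integralCurve_mulInvariantVectorField_unique {γ γ' : ℝ → G} {v : GroupLieAlgebra IG G}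
    {t : ℝ} (hγ : IsMIntegralCurve γ (mulInvariantVectorField v))
    (hγ' : IsMIntegralCurve γ' (mulInvariantVectorField v)) (h : γ t = γ' t) : γ = γ' := by
  have : CompleteSpace EG := FiniteDimensional.complete ℝ EG
  have hM : IsManifold IG 1 G := IsManifold.of_le (n := ∞) (by simp)
  exact isMIntegralCurve_Ioo_eq_of_contMDiff_boundaryless
    ((contMDiff_mulInvariantVectorField v).of_le (by simp)) hγ hγ' h

/-- Running `γ` at speed `t` gives an integral curve for `t • v`; uniqueness makes the curve chosen
in `lieExp` irrelevant. -/
theorem lieExp_smul_eq {γ : ℝ → G} {v : GroupLieAlgebra IG G} (h0 : γ 0 = 1)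
    (hγ : IsMIntegralCurve γ (mulInvariantVectorField v)) (t : ℝ) : lieExp IG (t • v) = γ t := by
  obtain ⟨h0', hγ'⟩ := (exists_integralCurve IG (G := G) (t • v)).choose_spec
  have h1 := hγ.comp_mul t
  rw [← mulInvariantVectorField_smul] at h1
  have h2 := integralCurve_mulInvariantVectorField_unique (t := 0) hγ' h1 (by simp [h0', h0])
  exact (congrFun h2 1).trans (by simp)

variable (IG) in
/-- The one-parameter subgroup of `G` with velocity `v` at the identity. -/
noncomputable def expCurve (G : Type*) [TopologicalSpace G] [ChartedSpace HG G] [Group G] [LieGroup IG ∞ G]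
    [T2Space G] (v : EG) (t : ℝ) : G :=
  lieExp IG (t • (show GroupLieAlgebra IG G from v))

theorem isMIntegralCurve_expCurve (v : EG) : IsMIntegralCurve (expCurve IG G v)
    (mulInvariantVectorField (show GroupLieAlgebra IG G from v)) := by
  obtain ⟨γ, h0, hγ⟩ := exists_integralCurve IG (G := G) v
  have h : expCurve IG G v = γ := funext (lieExp_smul_eq h0 hγ)
  rwa [h]

theorem expCurve_zero (v : EG) : expCurve IG G v 0 = 1 := by
  obtain ⟨γ, h0, hγ⟩ := exists_integralCurve IG (G := G) v
  exact (lieExp_smul_eq h0 hγ 0).trans h0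

theorem eq_expCurve {γ : ℝ → G} {v : EG} (h0 : γ 0 = 1) (hγ : IsMIntegralCurve γ
    (mulInvariantVectorField (show GroupLieAlgebra IG G from v))) : γ = expCurve IG G v :=
  integralCurve_mulInvariantVectorField_unique hγ (isMIntegralCurve_expCurve v)
    (h0.trans (expCurve_zero v).symm)

/-- As functions of `t`, both sides are integral curves of the same left-invariant field, and they
agree at `t = 0`. -/
theorem expCurve_add (v : EG) (s t : ℝ) :
    expCurve IG G v (s + t) = expCurve IG G v s * expCurve IG G v t := by
  have h1 := (isMIntegralCurve_expCurve (IG := IG) (G := G) v).comp_add s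
  have h2 : IsMIntegralCurve (fun t : ℝ => expCurve IG G v s * expCurve IG G v t)
      (mulInvariantVectorField (show GroupLieAlgebra IG G from v)) := by
    rw [isMIntegralCurve_iff_isMIntegralCurveOn]
    exact isMIntegralCurveOn_mul_left IG v
      ((isMIntegralCurve_expCurve v).isMIntegralCurveOn univ) _
  have h3 := integralCurve_mulInvariantVectorField_unique (t := 0) h1 h2
    (by simp only [Function.comp_apply, zero_add, expCurve_zero, mul_one])
  simpa only [Function.comp_apply, add_comm] using congrFun h3 t

theorem continuous_expCurve (v : EG) : Continuous (expCurve IG G v) :=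
  (isMIntegralCurve_expCurve v).continuous

/-- Conjugation carries the left-invariant field of `w` to that of `lieAd IG h w`, hence integral
curves to integral curves. -/
theorem expCurve_lieAd (h : G) (w : EG) (t : ℝ) :
    expCurve IG G (lieAd IG h w) t = h * expCurve IG G w t * h⁻¹ := by
  refine (congrFun (eq_expCurve (γ := fun t => h * expCurve IG G w t * h⁻¹)
    (by simp [expCurve_zero]) fun t => ?_) t).symm
  have h1 := (mdifferentiable_conj IG h (expCurve IG G w t)).hasMFDerivAt.comp t
    (isMIntegralCurve_expCurve w t)
  refine h1.congr_mfderiv ?_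
  refine ContinuousLinearMap.ext_ring ?_
  change modelDeriv IG IG (fun k : G => h * k * h⁻¹) (expCurve IG G w t)
    ((1 : ℝ) • leftField IG w (expCurve IG G w t)) =
    (1 : ℝ) • leftField IG (lieAd IG h w) (h * expCurve IG G w t * h⁻¹)
  rw [one_smul, one_smul, modelDeriv_conj_leftField]

theorem hasDerivAt_extChartAt_expCurve (v : EG) {t : ℝ}
    (ht : expCurve IG G v t ∈ (extChartAt IG (1 : G)).source) :
    HasDerivAt (fun t : ℝ => extChartAt IG (1 : G) (expCurve IG G v t))
      (fderiv ℝ (chartMul IG G)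
        (extChartAt IG (1 : G) (expCurve IG G v t), extChartAt IG (1 : G) 1) (0, v)) t := by
  have h1 := (mdifferentiableAt_extChartAt_one ht).hasMFDerivAt.comp t
    (isMIntegralCurve_expCurve v t)
  have h2 : HasFDerivAt (fun t : ℝ => extChartAt IG (1 : G) (expCurve IG G v t))
      (modelDeriv IG 𝓘(ℝ, EG) (extChartAt IG (1 : G)) (expCurve IG G v t) ∘L
        (1 : ℝ →L[ℝ] ℝ).smulRight (leftField IG v (expCurve IG G v t))) t :=
    hasMFDerivAt_iff_hasFDerivAt.1 h1
  have h3 := h2.hasDerivAt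
  rwa [ContinuousLinearMap.comp_apply, ContinuousLinearMap.smulRight_apply,
    one_apply_eq_self, one_smul, modelDeriv_extChartAt_leftField ht] at h3

theorem hasDerivAt_extChartAt_expCurve_zero (v : EG) :
    HasDerivAt (fun t : ℝ => extChartAt IG (1 : G) (expCurve IG G v t)) v 0 := by
  have h := hasDerivAt_extChartAt_expCurve (IG := IG) (G := G) v (t := 0)
    (by rw [expCurve_zero]; exact mem_extChartAt_source 1)
  rwa [expCurve_zero, fderiv_chartMul_one_right] at h

theorem expCurve_preimage_source_mem_nhds (v : EG) :
    expCurve IG G v ⁻¹' (extChartAt IG (1 : G)).source ∈ 𝓝 0 :=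
  ((isOpen_extChartAt_source (1 : G)).preimage (continuous_expCurve v)).mem_nhds
    (by rw [mem_preimage, expCurve_zero]; exact mem_extChartAt_source 1)

/-- The differential equation expresses the derivative in the chart as a continuous function of the
curve, which is itself continuous. -/
theorem contMDiffAt_expCurve (v : EG) :
    ContMDiffAt 𝓘(ℝ, ℝ) IG 1 (expCurve IG G v) 0 := by
  have hM : IsManifold IG 1 G := IsManifold.of_le (n := ∞) (by simp)
  rw [contMDiffAt_iff_target]
  refine ⟨(continuous_expCurve v).continuousAt, ?_⟩
  rw [expCurve_zero, contMDiffAt_iff_contDiffAt, contDiffAt_one_iff]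
  refine ⟨_, _, expCurve_preimage_source_mem_nhds v, ?_,
    fun t ht => (hasDerivAt_extChartAt_expCurve v ht).hasFDerivAt⟩
  intro t ht
  have h1 : ContinuousAt (fderiv ℝ (chartMul IG G))
      (extChartAt IG (1 : G) (expCurve IG G v t), extChartAt IG (1 : G) 1) :=
    ((contDiffAt_chartMul ht (mem_extChartAt_source 1) (by simpa using ht)).fderiv_right
      (m := 0) (by simp)).continuousAt
  have h2 : ContinuousAt (fun t : ℝ =>
      (extChartAt IG (1 : G) (expCurve IG G v t), extChartAt IG (1 : G) 1)) t :=
    (hasDerivAt_extChartAt_expCurve v ht).continuousAt.prodMk continuousAt_const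
  have h3 : ContinuousAt (fun t : ℝ => fderiv ℝ (chartMul IG G)
      (extChartAt IG (1 : G) (expCurve IG G v t), extChartAt IG (1 : G) 1)) t :=
    ContinuousAt.comp (f := fun t : ℝ =>
      (extChartAt IG (1 : G) (expCurve IG G v t), extChartAt IG (1 : G) 1)) h1 h2
  exact ((ContinuousLinearMap.toSpanSingletonCLE (𝕜 := ℝ) (E := EG)).continuous.continuousAt.comp
    (h3.clm_apply continuousAt_const)).continuousWithinAt

/-- If a subspace of the Lie algebra contains the conjugates of `w` by the one-parameter subgroup of
`v`, then it contains `⁅v, w⁆`. -/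
theorem lie_mem_of_lieAd_mem {K : Submodule ℝ (GroupLieAlgebra IG G)} {v w : GroupLieAlgebra IG G}
    (h : ∀ t : ℝ, (show GroupLieAlgebra IG G from lieAd IG (expCurve IG G v t) w) ∈ K) :
    ⁅v, w⁆ ∈ K := by
  have : CompleteSpace EG := FiniteDimensional.complete ℝ EG
  have hμ := contDiffAt_chartMul (IG := IG) (mem_extChartAt_source (1 : G))
    (mem_extChartAt_source (1 : G)) (by rw [mul_one]; exact mem_extChartAt_source 1)
  have key : ∀ (K : Submodule ℝ EG) (v w : EG), (∀ t : ℝ, lieAd IG (expCurve IG G v t) w ∈ K) →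
      VectorField.lieBracket ℝ
        (fun x => fderiv ℝ (chartMul IG G) (x, extChartAt IG (1 : G) 1) (0, v))
        (fun x => fderiv ℝ (chartMul IG G) (x, extChartAt IG (1 : G) 1) (0, w))
        (extChartAt IG (1 : G) 1) ∈ K := fun K v w h =>
    lieBracket_mem_of_conj_mem (hμ.of_le (by norm_cast)) fderiv_chartMul_one_left
      fderiv_chartMul_one_right (Submodule.closed_of_finiteDimensional K)
      (c := fun t : ℝ => extChartAt IG (1 : G) (expCurve IG G v t))
      (g := fun t => lieAd IG (expCurve IG G v t) w) (by rw [expCurve_zero])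
      (hasDerivAt_extChartAt_expCurve_zero (IG := IG) (G := G) v) h (by
        filter_upwards [expCurve_preimage_source_mem_nhds (IG := IG) (G := G) v] with t ht
        exact fderiv_chartMul_lieAd ht w)
  exact (congrArg (· ∈ K) (bracket_eq_lieBracket_chartMul v w)).mpr (key K v w h)

end ExponentialCurve

/-- Evaluates the product of exponentials on a coordinate axis, where all factors but one are
trivial. -/
theorem prod_map_eq_of_forall_ne {ι M : Type*} [Monoid M] {f : ι → M} {i : ι} {l : List ι}
    (hl : l.Nodup) (hi : i ∈ l) (hf : ∀ j, j ≠ i → f j = 1) : (l.map f).prod = f i := by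
  induction l with
  | nil => simp at hi
  | cons a l ih =>
    rw [List.nodup_cons] at hl
    rw [List.map_cons, List.prod_cons]
    by_cases ha : a = i
    · subst ha
      rw [List.prod_eq_one, mul_one]
      intro x hx
      obtain ⟨j, hj, rfl⟩ := List.mem_map.1 hx
      exact hf j fun h => hl.1 (h ▸ hj)
    · rw [hf a ha, one_mul]
      exact ih hl.2 ((List.mem_cons.1 hi).resolve_left fun h => ha h.symm)

/-! ### Subgroups containing enough one-parameter subgroups. -/

section Subgroups

variable {EG HG : Type*} [NormedAddCommGroup EG] [NormedSpace ℝ EG] [FiniteDimensional ℝ EG]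
  [TopologicalSpace HG] (IG : ModelWithCorners ℝ EG HG) [IG.Boundaryless]
  {G : Type*} [TopologicalSpace G] [ChartedSpace HG G] [Group G] [LieGroup IG ∞ G] [T2Space G]

theorem contMDiffAt_prod_expCurve {ι : Type*} [Fintype ι] (b : ι → EG) (l : List ι) :
    ContMDiffAt 𝓘(ℝ, ι → ℝ) IG 1
      (fun t : ι → ℝ => (l.map fun i => expCurve IG G (b i) (t i)).prod) 0 := by
  have hm : ContMDiffMul IG 1 G := ContMDiffMul.of_le (n := ∞) (by simp)
  induction l with
  | nil => exact contMDiffAt_const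
  | cons i l ih =>
    simp only [List.map_cons, List.prod_cons]
    refine ContMDiffAt.mul ?_ ih
    exact ContMDiffAt.comp_of_eq (I' := 𝓘(ℝ, ℝ)) (g := expCurve IG G (b i))
      (f := fun t : ι → ℝ => t i) (y := (0 : ℝ)) (contMDiffAt_expCurve (b i))
      (contDiff_apply ℝ ℝ i).contMDiff.contMDiffAt rfl

/-- A subgroup that contains the one-parameter subgroups of the members of a spanning set is a
neighbourhood of the identity. -/
theorem subgroup_mem_nhds_one_of_span (H : Subgroup G) {s : Set EG}
    (hs : Submodule.span ℝ s = ⊤) (h : ∀ v ∈ s, ∀ t, expCurve IG G v t ∈ H) :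
    (H : Set G) ∈ 𝓝 1 := by
  classical
  have : CompleteSpace EG := FiniteDimensional.complete ℝ EG
  obtain ⟨b, hbs, hb, hli⟩ := exists_linearIndependent ℝ s
  have hfin : Fintype b := hli.setFinite.fintype
  let P : (b → ℝ) → G := fun t =>
    ((Finset.univ : Finset b).toList.map fun i : b => expCurve IG G (i : EG) (t i)).prod
  have hPH : ∀ t, P t ∈ H := fun t => H.list_prod_mem fun x hx => by
    obtain ⟨i, -, rfl⟩ := List.mem_map.1 hx
    exact h i (hbs i.2) _
  have hP0 : P 0 = 1 := List.prod_eq_one fun x hx => by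
    obtain ⟨i, -, rfl⟩ := List.mem_map.1 hx
    exact expCurve_zero _
  have hPs : ∀ (i : b) (r : ℝ), P (Pi.single i r) = expCurve IG G (i : EG) r := by
    intro i r
    refine (prod_map_eq_of_forall_ne (i := i) (Finset.nodup_toList _) (by simp) ?_).trans
      (by simp)
    intro j hj
    rw [Pi.single_eq_of_ne hj, expCurve_zero]
  have hPc : ContMDiffAt 𝓘(ℝ, b → ℝ) IG 1 P 0 := contMDiffAt_prod_expCurve IG _ _
  have hQ : ContDiffAt ℝ 1 (fun t => extChartAt IG (1 : G) (P t)) 0 := by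
    rw [← contMDiffAt_iff_contDiffAt]
    exact ContMDiffAt.comp_of_eq (I' := IG)
      ((contMDiffAt_extChartAt_one (mem_extChartAt_source (1 : G))).of_le (by simp)) hPc hP0
  have hQ' := hQ.hasStrictFDerivAt (by simp)
  set L := fderiv ℝ (fun t => extChartAt IG (1 : G) (P t)) 0 with hL
  -- On the `i`-th axis `P` is the one-parameter subgroup of `i`, whose velocity at `0` is `i`. The
  -- order of the factors plays no role.
  have hLi : ∀ i : b, L (Pi.single i 1) = i := by
    intro i
    have h1 : HasDerivAt (fun r : ℝ => (Pi.single i r : b → ℝ)) (Pi.single i 1) 0 :=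
      (ContinuousLinearMap.single ℝ (fun _ : b => ℝ) i).hasDerivAt
    have h2 := HasFDerivAt.comp_hasDerivAt_of_eq (0 : ℝ) hQ'.hasFDerivAt h1
      (Pi.single_zero i).symm
    have h3 := hasDerivAt_extChartAt_expCurve_zero (IG := IG) (G := G) (i : EG)
    simp only [Function.comp_def, hPs] at h2
    exact h2.unique h3
  have hrange : (L : (b → ℝ) →ₗ[ℝ] EG).range = ⊤ := by
    rw [eq_top_iff, ← hs, ← hb, Submodule.span_le]
    intro v hv
    exact ⟨Pi.single ⟨v, hv⟩ 1, hLi ⟨v, hv⟩⟩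
  -- A surjective strict derivative makes the map locally open, so every point near `1` is some `P
  -- t`, which lies in `H`.
  have hmap := hQ'.map_nhds_eq_of_surj hrange
  rw [hP0] at hmap
  have hsrc : ∀ᶠ t in 𝓝 (0 : b → ℝ), P t ∈ (extChartAt IG (1 : G)).source :=
    hPc.continuousAt.eventually_mem (by rw [hP0]; exact extChartAt_source_mem_nhds 1)
  have h1 : ∀ᶠ x in 𝓝 (extChartAt IG (1 : G) 1), (extChartAt IG (1 : G)).symm x ∈ H := by
    rw [← hmap, eventually_map]
    filter_upwards [hsrc] with t ht
    rw [(extChartAt IG (1 : G)).left_inv ht]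
    exact hPH t
  filter_upwards [(continuousAt_extChartAt (I := IG) (1 : G)).eventually h1,
    extChartAt_source_mem_nhds (I := IG) (1 : G)] with k hk hks
  rwa [(extChartAt IG (1 : G)).left_inv hks] at hk

/-- A subgroup that contains the one-parameter subgroups of generators of the Lie algebra is a
neighbourhood of the identity. -/
theorem subgroup_mem_nhds_one_of_lieSpan (H : Subgroup G) {s : Set (GroupLieAlgebra IG G)}
    (hs : LieSubalgebra.lieSpan ℝ (GroupLieAlgebra IG G) s = ⊤)
    (h : ∀ v ∈ s, ∀ t, expCurve IG G v t ∈ H) : (H : Set G) ∈ 𝓝 1 := by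
  -- `S` is not shown to be closed under addition; passing to its span avoids this, since only a
  -- spanning set is needed in the end.
  let S : Set EG := {v | ∀ t, expCurve IG G v t ∈ H}
  refine subgroup_mem_nhds_one_of_span IG H (s := S) ?_ fun v hv => hv
  have hAd : ∀ k ∈ H, ∀ w ∈ Submodule.span ℝ S, lieAd IG k w ∈ Submodule.span ℝ S := by
    intro k hk w hw
    induction hw using Submodule.span_induction with
    | mem v hv =>
      refine Submodule.subset_span fun t => ?_
      rw [expCurve_lieAd]
      exact H.mul_mem (H.mul_mem hk (hv t)) (H.inv_mem hk)
    | zero => rw [map_zero]; exact Submodule.zero_mem _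
    | add x y _ _ hx hy => rw [map_add]; exact Submodule.add_mem _ hx hy
    | smul a x _ hx => rw [map_smul]; exact Submodule.smul_mem _ a hx
  let K : Submodule ℝ (GroupLieAlgebra IG G) :=
    Submodule.span ℝ (show Set (GroupLieAlgebra IG G) from S)
  have hlie : ∀ v ∈ K, ∀ w ∈ K, ⁅v, w⁆ ∈ K := by
    intro v hv w hw
    -- Linearity in `v` reduces to `v ∈ S`, where the conjugating elements lie in `H`; `w` may stay
    -- arbitrary in `K`, as `Ad` of `H` preserves all of `K`.
    induction hv using Submodule.span_induction with
    | mem v hv => exact lie_mem_of_lieAd_mem fun t => hAd _ (hv t) w hw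
    | zero => rw [zero_lie]; exact K.zero_mem
    | add x y _ _ hx hy => rw [add_lie]; exact K.add_mem hx hy
    | smul a x _ hx => rw [smul_lie]; exact K.smul_mem a hx
  let KL : LieSubalgebra ℝ (GroupLieAlgebra IG G) :=
    { K with lie_mem' := fun {v w} hv hw => hlie v hv w hw }
  have htop : (⊤ : LieSubalgebra ℝ (GroupLieAlgebra IG G)) ≤ KL := by
    rw [← hs, LieSubalgebra.lieSpan_le]
    exact fun v hv => Submodule.subset_span (h v hv)
  exact eq_top_iff.2 fun v _ => htop (LieSubalgebra.mem_top (R := ℝ) (show GroupLieAlgebra IG G from v))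

theorem expCurve_mem_connectedComponent (v : EG) (t : ℝ) :
    expCurve IG G v t ∈ connectedComponent (1 : G) :=
  (isPreconnected_range (continuous_expCurve v)).subset_connectedComponent
    ⟨0, expCurve_zero v⟩ ⟨t, rfl⟩

end Subgroups

/-! ### From a neighbourhood of the identity to whole components. -/

section Components

variable {G : Type*} [TopologicalSpace G] [Group G] [IsTopologicalGroup G]

theorem connectedComponent_one_subset_of_mem_nhds (H : Subgroup G) (h : (H : Set G) ∈ 𝓝 1) :
    connectedComponent (1 : G) ⊆ H :=
  have ho := H.isOpen_of_mem_nhds h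
  IsClopen.connectedComponent_subset ⟨H.isClosed_of_isOpen ho, ho⟩ H.one_mem

theorem mem_of_connectedComponent_one_subset {ι : Type*} (H : Subgroup G)
    (h1 : connectedComponent (1 : G) ⊆ H) (g : ι → G)
    (hg : ∀ c : ConnectedComponents G, c ≠ ConnectedComponents.mk (1 : G) →
      ∃ j, ConnectedComponents.mk (g j) = c)
    (hgH : ∀ j, g j ∈ H) (h : G) : h ∈ H := by
  by_cases hc : ConnectedComponents.mk h = ConnectedComponents.mk (1 : G)
  · apply h1
    rw [← ConnectedComponents.coe_eq_coe.1 hc]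
    exact mem_connectedComponent
  · obtain ⟨j, hj⟩ := hg _ hc
    have h2 : h ∈ connectedComponent (g j) := by
      rw [ConnectedComponents.coe_eq_coe.1 hj]
      exact mem_connectedComponent
    -- Translation by `(g j)⁻¹` sends the component of `g j` to a connected set through `1`.
    have h3 : (g j)⁻¹ * h ∈ connectedComponent (1 : G) :=
      (isPreconnected_connectedComponent.image (fun k => (g j)⁻¹ * k)
        (continuous_const_mul _).continuousOn).subset_connectedComponent
        ⟨g j, mem_connectedComponent, inv_mul_cancel _⟩ ⟨h, h2, rfl⟩
    simpa using H.mul_mem (hgH j) (h1 h3)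

end Components

/-- Allows identities between sections to be checked in the total space, without casts between
fibres. -/
theorem mk_fiberElt {M R : Type*} {E : M → Type*} {p : M} (v : TotalSpace R E) (h : v.proj = p) :
    (⟨p, fiberElt p v h⟩ : TotalSpace R E) = v := by
  subst h
  rfl

/-! ### Representations on sections that act fibrewise. -/

section Representation

variable {EG HG : Type*} [NormedAddCommGroup EG] [NormedSpace ℝ EG] [FiniteDimensional ℝ EG]
  [TopologicalSpace HG] {IG : ModelWithCorners ℝ EG HG} [IG.Boundaryless]
  {G : Type*} [TopologicalSpace G] [ChartedSpace HG G] [Group G] [LieGroup IG ∞ G] [T2Space G]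
  {P : Type*} {E : P → Type*} [∀ p, AddCommGroup (E p)] [∀ p, Module ℝ (E p)]
  [∀ p, TopologicalSpace (E p)] {R : Type*} [NormedAddCommGroup R] [NormedSpace ℝ R]
  [FiniteDimensional ℝ R] {K : G → (∀ p, E p) →ₗ[ℝ] (∀ p, E p)}

/-- The subgroup of the elements that fix a section. -/
def fixingSubgroup (hone : ∀ F, K 1 F = F) (hmul : ∀ g h F, K (g * h) F = K g (K h F))
    (F : ∀ p, E p) : Subgroup G where
  carrier := {g | K g F = F}
  mul_mem' {g h} hg hh := by
    rw [mem_ofPred_eq] at hg hh ⊢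
    rw [hmul, hh, hg]
  one_mem' := hone F
  inv_mem' {g} hg := by
    rw [mem_ofPred_eq] at hg ⊢
    nth_rewrite 1 [← hg]
    rw [← hmul, inv_mul_cancel, hone]

/-- The common core of the bundle case and the vector-space case: both operators `K` satisfy `hone`,
`hmul` and `hloc`. -/
theorem connectedComponent_one_subset_fixingSubgroup (e : ∀ p, E p ≃L[ℝ] R)
    (hone : ∀ F, K 1 F = F) (hmul : ∀ g h F, K (g * h) F = K g (K h F))
    (hloc : ∀ g p, ∃ q, ∃ L : E q →ₗ[ℝ] E p, ∀ F, K g F p = L (F q)) (F : ∀ p, E p)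
    {ι : Type*} (ξ : ι → GroupLieAlgebra IG G)
    (hξ : LieSubalgebra.lieSpan ℝ (GroupLieAlgebra IG G) (Set.range ξ) = ⊤)
    (h : ∀ i, Tendsto (fun t : ℝ => t⁻¹ • (K (lieExp IG (t • ξ i)) F - F)) (𝓝[≠] 0) (𝓝 0)) :
    connectedComponent (1 : G) ⊆ fixingSubgroup hone hmul F := by
  have : IsTopologicalGroup G := topologicalGroup_of_lieGroup IG ∞
  refine connectedComponent_one_subset_of_mem_nhds _ (subgroup_mem_nhds_one_of_lieSpan IG _ hξ ?_)
  rintro _ ⟨i, rfl⟩ t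
  refine eq_self_of_tendsto_generator_zero e (fun t => K (expCurve IG G (ξ i) t)) F ?_
    (fun s t => ?_) (fun t p => hloc _ p) (h i) t
  · change K (expCurve IG G (show EG from ξ i) 0) F = F
    rw [expCurve_zero, hone]
  · change K (expCurve IG G (show EG from ξ i) (s + t)) F = _
    rw [expCurve_add, hmul]

theorem tendsto_zero_of_forall_mem_connectedComponent (F : ∀ p, E p)
    (h : ∀ k ∈ connectedComponent (1 : G), K k F = F) (v : GroupLieAlgebra IG G) :
    Tendsto (fun t : ℝ => t⁻¹ • (K (lieExp IG (t • v)) F - F)) (𝓝[≠] 0) (𝓝 0) := by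
  have h0 : ∀ t : ℝ, t⁻¹ • (K (lieExp IG (t • v)) F - F) = 0 := fun t => by
    rw [h (lieExp IG (t • v)) (expCurve_mem_connectedComponent IG v t), sub_self, smul_zero]
  simp only [h0, tendsto_const_nhds]

end Representation

/-! ### Sections of vector bundles. -/

namespace FiberLinearAction

variable {EG HG : Type*} [NormedAddCommGroup EG] [NormedSpace ℝ EG]
  [TopologicalSpace HG] {IG : ModelWithCorners ℝ EG HG}
  {G : Type*} [TopologicalSpace G] [ChartedSpace HG G] [Group G]
  {EM HM : Type*} [NormedAddCommGroup EM] [NormedSpace ℝ EM]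
  [TopologicalSpace HM] {IM : ModelWithCorners ℝ EM HM}
  {M : Type*} [TopologicalSpace M] [ChartedSpace HM M]
  {R : Type*} [NormedAddCommGroup R] [NormedSpace ℝ R]
  {E : M → Type*} [∀ p, AddCommGroup (E p)] [∀ p, Module ℝ (E p)]
  [TopologicalSpace (TotalSpace R E)] [∀ p, TopologicalSpace (E p)] [FiberBundle R E]
  (Θ : FiberLinearAction IG G IM R E)

theorem mk_K (g : G) (F : ∀ p, E p) (p : M) : (⟨p, Θ.K g F p⟩ : TotalSpace R E) =
    Θ.total.act ⟨Θ.base.act p g, F (Θ.base.act p g)⟩ g⁻¹ :=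
  mk_fiberElt _ _

theorem K_one (F : ∀ p, E p) : Θ.K 1 F = F := by
  funext p
  refine TotalSpace.mk_inj.1 ((Θ.mk_K 1 F p).trans ?_)
  rw [Θ.base.act_one, inv_one, Θ.total.act_one]

/-- In the total space both sides are `F` at `p · g · h`, moved back by `h⁻¹` and then `g⁻¹`. -/
theorem K_mul (g h : G) (F : ∀ p, E p) : Θ.K (g * h) F = Θ.K g (Θ.K h F) := by
  funext p
  refine TotalSpace.mk_inj.1 ((Θ.mk_K (g * h) F p).trans
    (Eq.trans ?_ (Θ.mk_K g (Θ.K h F) p).symm))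
  rw [Θ.mk_K, Θ.total.act_act, Θ.base.act_act, mul_inv_rev]

theorem exists_K_apply_eq (g : G) (p : M) :
    ∃ q, ∃ L : E q →ₗ[ℝ] E p, ∀ F, Θ.K g F p = L (F q) := by
  obtain ⟨L, hL⟩ := Θ.exists_linear_fiberElt p (Θ.base.act p g) g⁻¹
    (by rw [Θ.base.act_act, mul_inv_cancel, Θ.base.act_one])
  exact ⟨_, L, fun F => hL _ _⟩

theorem exists_lieDeriv_eq_zero_iff [FiniteDimensional ℝ EG] [IG.Boundaryless] [LieGroup IG ∞ G]
    [T2Space G] [VectorBundle ℝ R E] (v : GroupLieAlgebra IG G) (F : ∀ p, E p) :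
    (∃ h : F ∈ (Θ.lieDeriv v).domain, Θ.lieDeriv v ⟨F, h⟩ = 0) ↔
      Tendsto (fun t : ℝ => t⁻¹ • (Θ.K (lieExp IG (t • v)) F - F)) (𝓝[≠] 0) (𝓝 0) := by
  have := fun p => (fiber_topology (R := R) E p).1
  have := fun p => (fiber_topology (R := R) E p).2.1
  have := fun p => (fiber_topology (R := R) E p).2.2
  exact exists_generatorAtZero_eq_zero_iff (fun t : ℝ => Θ.K (lieExp IG (t • v))) F

end FiberLinearAction

/-! ### Maps between vector spaces. -/

namespace ProductAction

variable {EG HG : Type*} [NormedAddCommGroup EG] [NormedSpace ℝ EG]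
  [TopologicalSpace HG] {IG : ModelWithCorners ℝ EG HG}
  {G : Type*} [TopologicalSpace G] [ChartedSpace HG G] [Group G]
  {V W : Type*} [NormedAddCommGroup V] [NormedSpace ℝ V] [NormedAddCommGroup W] [NormedSpace ℝ W]
  (Θ : ProductAction IG G V W)

theorem K_one (f : V → W) : Θ.K 1 f = f := by
  funext x
  change (Θ.T x 1).symm (f (Θ.base.act x 1)) = f x
  rw [Θ.base.act_one, ContinuousLinearEquiv.symm_apply_eq, Θ.T_one]

theorem K_mul (g h : G) (f : V → W) : Θ.K (g * h) f = Θ.K g (Θ.K h f) := by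
  funext x
  change (Θ.T x (g * h)).symm (f (Θ.base.act x (g * h))) = (Θ.T x g).symm
    ((Θ.T (Θ.base.act x g) h).symm (f (Θ.base.act (Θ.base.act x g) h)))
  rw [ContinuousLinearEquiv.symm_apply_eq, Θ.T_mul]
  simp [Θ.base.act_act]

theorem exists_K_apply_eq (g : G) (x : V) :
    ∃ y : V, ∃ L : W →ₗ[ℝ] W, ∀ f : V → W, Θ.K g f x = L (f y) :=
  ⟨Θ.base.act x g, (Θ.T x g).symm.toLinearMap, fun _ => rfl⟩

/-- The cocycle identity turns inversion of operators into inversion in `G`, so smoothness of the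
inverse operators reduces to that of `T`. -/
theorem T_symm_apply (x : V) (g : G) (y : W) :
    (Θ.T x g).symm y = Θ.T (Θ.base.act x g) g⁻¹ y := by
  rw [ContinuousLinearEquiv.symm_apply_eq]
  have h := Θ.T_mul (Θ.base.act x g) g⁻¹ g y
  rwa [inv_mul_cancel, Θ.T_one, Θ.base.act_act, mul_inv_cancel, Θ.base.act_one] at h

variable [FiniteDimensional ℝ EG] [IG.Boundaryless] [LieGroup IG ∞ G] [T2Space G]

theorem exists_lieDeriv_eq_zero_iff (v : GroupLieAlgebra IG G) (f : V → W) :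
    (∃ h : f ∈ (Θ.lieDeriv v).domain, Θ.lieDeriv v ⟨f, h⟩ = 0) ↔
      Tendsto (fun t : ℝ => t⁻¹ • (Θ.K (lieExp IG (t • v)) f - f)) (𝓝[≠] 0) (𝓝 0) :=
  exists_generatorAtZero_eq_zero_iff (fun t : ℝ => Θ.K (lieExp IG (t • v))) f

theorem differentiableAt_K_expCurve {f : V → W} (hf : ContDiff ℝ 1 f) (v : EG) (x : V) :
    DifferentiableAt ℝ (fun t : ℝ => Θ.K (expCurve IG G v t) f x) 0 := by
  have hG : LieGroup IG 1 G := LieGroup.of_le (n := ∞) (by simp)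
  have hγ := contMDiffAt_expCurve (IG := IG) (G := G) v
  have hθ : ContMDiffAt 𝓘(ℝ, ℝ) 𝓘(ℝ, V) 1 (fun t => Θ.base.act x (expCurve IG G v t)) 0 :=
    ContMDiffAt.comp (I' := 𝓘(ℝ, V).prod IG) (0 : ℝ) (f := fun t => (x, expCurve IG G v t))
      (Θ.base.contMDiff_act.contMDiffAt.of_le (by simp)) (contMDiffAt_const.prodMk hγ)
  have hT : ContMDiffAt 𝓘(ℝ, ℝ) 𝓘(ℝ, W →L[ℝ] W) 1 (fun t =>
      (Θ.T (Θ.base.act x (expCurve IG G v t)) (expCurve IG G v t)⁻¹ : W →L[ℝ] W)) 0 :=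
    ContMDiffAt.comp (I' := 𝓘(ℝ, V).prod IG) (0 : ℝ)
      (f := fun t => (Θ.base.act x (expCurve IG G v t), (expCurve IG G v t)⁻¹))
      (Θ.contMDiff_T.contMDiffAt.of_le (by simp)) (hθ.prodMk hγ.inv)
  have h := (contMDiffAt_iff_contDiffAt.1 hT).clm_apply
    (hf.contDiffAt.comp (0 : ℝ) (contMDiffAt_iff_contDiffAt.1 hθ))
  refine (h.differentiableAt (by simp)).congr_of_eventuallyEq (Eventually.of_forall fun t => ?_)
  exact Θ.T_symm_apply x (expCurve IG G v t) _

theorem mem_domain_lieDeriv {f : V → W} (hf : ContDiff ℝ 1 f) (v : GroupLieAlgebra IG G) :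
    f ∈ (Θ.lieDeriv v).domain := by
  refine ⟨fun x => deriv (fun t : ℝ => Θ.K (expCurve IG G v t) f x) 0, tendsto_pi_nhds.2 fun x => ?_⟩
  have h := (Θ.differentiableAt_K_expCurve hf v x).hasDerivAt
  rw [hasDerivAt_iff_tendsto_slope_zero] at h
  have h0 : ∀ v : EG, Θ.K (expCurve IG G v 0) f = f := fun v => by rw [expCurve_zero, Θ.K_one]
  refine h.congr fun t => ?_
  rw [zero_add, h0 v]
  rfl

end ProductAction

end SymLie

theorem mainTheorem2
    {EG HG : Type*} [NormedAddCommGroup EG] [NormedSpace ℝ EG] [FiniteDimensional ℝ EG]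
    [TopologicalSpace HG] {IG : ModelWithCorners ℝ EG HG} [IG.Boundaryless]
    {G : Type*} [TopologicalSpace G] [ChartedSpace HG G] [Group G] [LieGroup IG ∞ G] [T2Space G]
    {q m : ℕ}
    -- generators of the Lie algebra of `G`
    (ξ : Fin q → GroupLieAlgebra IG G)
    (hξ : LieSubalgebra.lieSpan ℝ (GroupLieAlgebra IG G) (Set.range ξ) = ⊤)
    -- `G` has `m + 1` components, and the `g j` represent the `m` non-identity components
    (hcomp : Nat.card (ConnectedComponents G) = m + 1)
    (g : Fin m → G)
    (hg : ∀ c : ConnectedComponents G, c ≠ ConnectedComponents.mk (1 : G) →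
      ∃ j, ConnectedComponents.mk (g j) = c)
    -- a smooth vector bundle with a fibre-linear action, and a continuous section
    {EM HM : Type*} [NormedAddCommGroup EM] [NormedSpace ℝ EM] [TopologicalSpace HM]
    {IM : ModelWithCorners ℝ EM HM}
    {M : Type*} [TopologicalSpace M] [ChartedSpace HM M] [IsManifold IM ∞ M]
    {R : Type*} [NormedAddCommGroup R] [NormedSpace ℝ R] [FiniteDimensional ℝ R]
    {E : M → Type*} [∀ p, AddCommGroup (E p)] [∀ p, Module ℝ (E p)]
    [TopologicalSpace (Bundle.TotalSpace R E)] [∀ p, TopologicalSpace (E p)] [FiberBundle R E]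
    [VectorBundle ℝ R E] [ContMDiffVectorBundle ∞ R E IM]
    (Θ : SymLie.FiberLinearAction IG G IM R E)
    (F : ∀ p, E p) (hF : Continuous fun p => (⟨p, F p⟩ : Bundle.TotalSpace R E))
    -- vector spaces with an action on their product, and a continuously differentiable map
    {V W : Type*} [NormedAddCommGroup V] [NormedSpace ℝ V] [FiniteDimensional ℝ V]
    [NormedAddCommGroup W] [NormedSpace ℝ W] [FiniteDimensional ℝ W]
    (Ψ : SymLie.ProductAction IG G V W)
    (f : V → W) (hf : ContDiff ℝ 1 f) :
    -- equivariance under the identity component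
    ((∀ h ∈ connectedComponent (1 : G), Θ.K h F = F) ↔
      ∀ i, ∃ hi : F ∈ (Θ.lieDeriv (ξ i)).domain, Θ.lieDeriv (ξ i) ⟨F, hi⟩ = 0) ∧
    -- equivariance under `G`
    ((∀ i, ∃ hi : F ∈ (Θ.lieDeriv (ξ i)).domain, Θ.lieDeriv (ξ i) ⟨F, hi⟩ = 0) →
      (∀ j, Θ.K (g j) F = F) → ∀ h : G, Θ.K h F = F) ∧
    -- the vector-space case
    ∃ hD : ∀ η : GroupLieAlgebra IG G, f ∈ (Ψ.lieDeriv η).domain,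
      ((∀ h : G, Ψ.K h f = f) ↔
        (∀ i, Ψ.lieDeriv (ξ i) ⟨f, hD (ξ i)⟩ = 0) ∧ ∀ j, Ψ.K (g j) f - f = 0) := by

  have : IsTopologicalGroup G := topologicalGroup_of_lieGroup IG ∞
  have hcc : ∀ F : ∀ p, E p,
      (∀ i, ∃ hi : F ∈ (Θ.lieDeriv (ξ i)).domain, Θ.lieDeriv (ξ i) ⟨F, hi⟩ = 0) →
      connectedComponent (1 : G) ⊆ SymLie.fixingSubgroup Θ.K_one Θ.K_mul F := fun F h =>
    SymLie.connectedComponent_one_subset_fixingSubgroup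
      (fun p => (trivializationAt R E p).continuousLinearEquivAt ℝ p
        (mem_baseSet_trivializationAt R E p))
      Θ.K_one Θ.K_mul Θ.exists_K_apply_eq F ξ hξ
      fun i => (Θ.exists_lieDeriv_eq_zero_iff (ξ i) F).1 (h i)
  refine ⟨⟨fun h i => (Θ.exists_lieDeriv_eq_zero_iff (ξ i) F).2
    (SymLie.tendsto_zero_of_forall_mem_connectedComponent F h (ξ i)), fun h => hcc F h⟩,
    fun h hgF => SymLie.mem_of_connectedComponent_one_subset
      (SymLie.fixingSubgroup Θ.K_one Θ.K_mul F) (hcc F h) g hg hgF,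
    Ψ.mem_domain_lieDeriv hf, fun h => ⟨fun i => ?_, fun j => sub_eq_zero.2 (h (g j))⟩,
    fun ⟨h, hgf⟩ => SymLie.mem_of_connectedComponent_one_subset
      (SymLie.fixingSubgroup Ψ.K_one Ψ.K_mul f) ?_ g hg fun j => sub_eq_zero.1 (hgf j)⟩
  -- The membership proof hidden in the existential agrees with the required one by proof
  -- irrelevance.
  · exact ((Ψ.exists_lieDeriv_eq_zero_iff (ξ i) f).2
      (SymLie.tendsto_zero_of_forall_mem_connectedComponent (E := fun _ : V => W) f
        (fun k _ => h k) (ξ i))).2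
  · exact SymLie.connectedComponent_one_subset_fixingSubgroup
      (fun _ => ContinuousLinearEquiv.refl ℝ W) Ψ.K_one Ψ.K_mul Ψ.exists_K_apply_eq f ξ hξ
      fun i => (Ψ.exists_lieDeriv_eq_zero_iff (ξ i) f).1 ⟨_, h i⟩
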